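/- Let $s=s[0..n-1]$ ($n\ge 0$) be a word over a totally ordered alphabet. A Lyndon word is a non-empty primitive word that is minimal, in lexicographic order, among its cyclic rotations. The suffix array of a word is the list of the starting positions of its non-empty suffixes, in lexicographic order of these suffixes; the Lyndon suffix array of $s$ is the lexicographically sorted list of (the starting positions of) exactly those suffixes of $s$ that are Lyndon words. Let \$ be an end marker smaller than every letter, and let $A[0..n-1]$ be the suffix array of $s\$$ without the entry $n$ of the suffix \$ itself. The procedure ComputeLSA starts with $i=n$, $j=n$ and an array $L[0..n-1]$ filled with $-1$. While the range $A[0],\dots,A[i-1]$ is non-empty, it finds the index $idx<i$ of the maximum of this range, sets $i\leftarrow idx$, $j\leftarrow j-1$, and $L[j]\leftarrow A[idx]$. Then: (a) The entries found, in the order in which they stand in $L$ (the last one found first), form exactly the Lyndon suffix array of $s$; thus on return $L$ consists of entries $-1$ followed by the Lyndon suffix array of $s$. (b) Call a pair of word-RAM programs a prefix RMQ structure with constant $c$ if, for every array $A[0..n-1]$ with entries in $\{0,\dots,n\}$, the first program preprocesses $A$ (its own memory being initially $0$) in at most $c(n+1)$ steps, after which the second finds, for each $1\le i\le n$, in at most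 $c$ steps an index at which $A[0],\dots,A[i-1]$ is maximal; all machine words are bounded by $c(n+1)$ in absolute value, the queries keep all arrays unchanged and rely only on the arrays, $n$ and $i$ (not on other register contents), and neither program changes the arrays and registers of ComputeLSA apart from the register holding the answer to a query. Such a structure exists for some $c$. For every $c$ there is a constant $C$ such that, for every prefix RMQ structure with constant $c$, every alphabet and every word $s$ of length $n$, the word-RAM program for ComputeLSA that answers its range maximum queries by this structure, given $n$ and the suffix array of $s\$$, halts with the array $L$ described in (a) after at most $C(n+1)$ steps, accessing at most $C(n+1)$ memory cells, with all machine words bounded by $C(n+1)$ in absolute value. So ComputeLSA runs in linear time and space. -/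

import Mathlib

namespace LyndonSuffix

/-! ### Words, Lyndon words, suffix arrays (positions are counted from `0`) -/

/-- A word is primitive if it is not a power `u ^ k` of a non-empty word with `k ≥ 2`. -/
def IsPrimitive {α : Type*} (w : List α) : Prop :=
  ∀ (u : List α) (k : ℕ), u ≠ [] → 2 ≤ k → w ≠ (List.replicate k u).flatten

/-- A Lyndon word: a non-empty primitive word that is minimal, in lexicographic order, among its
cyclic rotations. -/
def IsLyndon {α : Type*} [LinearOrder α] (w : List α) : Prop :=
  w ≠ [] ∧ IsPrimitive w ∧ ∀ v : List α, w ~r v → w ≤ v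

/-- The word `s$`, where the end marker `$` (here `⊥`) is smaller than every letter. -/
def withSentinel {α : Type*} (s : List α) : List (WithBot α) :=
  s.map (fun a => (a : WithBot α)) ++ [⊥]

/-- The list `P` of positions of `w`, sorted by the lexicographic order of the suffixes of `w`
that start there. -/
def sortBySuffix {α : Type*} [LinearOrder α] (w : List α) (P : List ℕ) : List ℕ :=
  P.mergeSort (fun p q => decide (w.drop p ≤ w.drop q))

/-- The suffix array of `w`: the starting positions of all non-empty suffixes of `w`, sorted. -/
def suffixArray {α : Type*} [LinearOrder α] (w : List α) : List ℕ :=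
  sortBySuffix w (List.range w.length)

open Classical in
/-- The Lyndon suffix array of `s`: the starting positions of exactly those suffixes of `s` that
are Lyndon words, in lexicographic order of these suffixes. -/
noncomputable def lyndonSuffixArray {α : Type*} [LinearOrder α] (s : List α) : List ℕ :=
  sortBySuffix s ((List.range s.length).filter (fun p => decide (IsLyndon (s.drop p))))

/-! ### The procedure, on lists -/

/-- One run of the loop: as long as the range `A[0], …, A[i-1]` is non-empty, find the index `idx`
of its maximal entry, put this entry in front of the output, and continue with the range before
`idx`. -/
def computeLoop (A : List ℕ) (i : ℕ) (out : List ℕ) : List ℕ :=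
  match _h : (List.range i).argmax (fun k => A.getD k 0) with
  | none => out
  | some idx => computeLoop A idx (A.getD idx 0 :: out)
termination_by i
decreasing_by exact List.mem_range.1 (List.argmax_mem _h)

/-- The procedure applied to the suffix array `B` of `s$`. The first entry of `B` belongs to
the suffix `$`, which is no suffix of `s`; it is left out. -/
def computeLSA (B : List ℕ) : List ℕ :=
  computeLoop B.tail B.tail.length []

/-! ### A word RAM with a step count

Programs work on integer registers and on integer arrays, both named by natural numbers. -/

/-- A machine state: the contents of the registers, and the cells of the arrays. -/
structure State where
  reg : ℕ → ℤ
  arr : ℕ → ℕ → ℤ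

/-- Write `v` into register `r`. -/
def State.setReg (σ : State) (r : ℕ) (v : ℤ) : State :=
  { σ with reg := Function.update σ.reg r v }

/-- Write `v` into cell `k` of array `a`. -/
def State.setCell (σ : State) (a k : ℕ) (v : ℤ) : State :=
  { σ with arr := Function.update σ.arr a (Function.update (σ.arr a) k v) }

/-- The arithmetic operations of the machine. -/
inductive Op where
  | plus | minus | times | quot | rem

/-- The value of an arithmetic operation (`quot` and `rem` are division with remainder). -/
def Op.eval : Op → ℤ → ℤ → ℤ
  | .plus, x, y => x + y
  | .minus, x, y => x - y
  | .times, x, y => x * y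
  | .quot, x, y => x / y
  | .rem, x, y => x % y

/-- Programs. `const r v` is `r ← v`, `move r x` is `r ← x`, `arith o r x y` is `r ← x o y`,
`load r a x` is `r ← a[x]`, `store a x y` is `a[x] ← y`; the tests of `ite x y` and `loop x y` are
`x < y`, where `x`, `y` are registers. -/
inductive Cmd where
  | skip
  | const (r : ℕ) (v : ℤ)
  | move (r x : ℕ)
  | arith (o : Op) (r x y : ℕ)
  | load (r a x : ℕ)
  | store (a x y : ℕ)
  | seq (p q : Cmd)
  | ite (x y : ℕ) (p q : Cmd)
  | loop (x y : ℕ) (p : Cmd)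

/-- `Exec W p σ t S σ'`: started in the state `σ`, the program `p` halts in the state `σ'` after
`t` steps; `S` is the set of array cells it accesses, and the machine words (all values written
and all addresses used) are bounded by `W` in absolute value. Each elementary instruction and each
evaluation of a test is one step. -/
inductive Exec (W : ℕ) : Cmd → State → ℕ → Finset (ℕ × ℕ) → State → Prop where
  | skip (σ : State) : Exec W .skip σ 1 ∅ σ
  | const (σ : State) (r : ℕ) (v : ℤ) (hv : |v| ≤ (W : ℤ)) :
      Exec W (.const r v) σ 1 ∅ (σ.setReg r v)
  | move (σ : State) (r x : ℕ) (hv : |σ.reg x| ≤ (W : ℤ)) :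
      Exec W (.move r x) σ 1 ∅ (σ.setReg r (σ.reg x))
  | arith (σ : State) (o : Op) (r x y : ℕ) (hv : |o.eval (σ.reg x) (σ.reg y)| ≤ (W : ℤ)) :
      Exec W (.arith o r x y) σ 1 ∅ (σ.setReg r (o.eval (σ.reg x) (σ.reg y)))
  | load (σ : State) (r a x k : ℕ) (hk : σ.reg x = (k : ℤ)) (hW : k ≤ W)
      (hv : |σ.arr a k| ≤ (W : ℤ)) :
      Exec W (.load r a x) σ 1 {(a, k)} (σ.setReg r (σ.arr a k))
  | store (σ : State) (a x y k : ℕ) (hk : σ.reg x = (k : ℤ)) (hW : k ≤ W)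
      (hv : |σ.reg y| ≤ (W : ℤ)) :
      Exec W (.store a x y) σ 1 {(a, k)} (σ.setCell a k (σ.reg y))
  | seq (p q : Cmd) (σ σ₁ σ₂ : State) (t₁ t₂ : ℕ) (S₁ S₂ : Finset (ℕ × ℕ))
      (h₁ : Exec W p σ t₁ S₁ σ₁) (h₂ : Exec W q σ₁ t₂ S₂ σ₂) :
      Exec W (.seq p q) σ (t₁ + t₂) (S₁ ∪ S₂) σ₂
  | iteTrue (x y : ℕ) (p q : Cmd) (σ σ₁ : State) (t : ℕ) (S : Finset (ℕ × ℕ))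
      (hb : σ.reg x < σ.reg y) (h : Exec W p σ t S σ₁) :
      Exec W (.ite x y p q) σ (t + 1) S σ₁
  | iteFalse (x y : ℕ) (p q : Cmd) (σ σ₁ : State) (t : ℕ) (S : Finset (ℕ × ℕ))
      (hb : ¬ σ.reg x < σ.reg y) (h : Exec W q σ t S σ₁) :
      Exec W (.ite x y p q) σ (t + 1) S σ₁
  | loopDone (x y : ℕ) (p : Cmd) (σ : State) (hb : ¬ σ.reg x < σ.reg y) :
      Exec W (.loop x y p) σ 1 ∅ σ
  | loopStep (x y : ℕ) (p : Cmd) (σ σ₁ σ₂ : State) (t₁ t₂ : ℕ) (S₁ S₂ : Finset (ℕ × ℕ))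
      (hb : σ.reg x < σ.reg y) (h₁ : Exec W p σ t₁ S₁ σ₁)
      (h₂ : Exec W (.loop x y p) σ₁ t₂ S₂ σ₂) :
      Exec W (.loop x y p) σ (t₁ + t₂ + 1) (S₁ ∪ S₂) σ₂

/-- Sequential composition of a list of programs. -/
def block : List Cmd → Cmd
  | [] => .skip
  | p :: ps => .seq p (block ps)

/-! ### The procedure as a program

Registers `0, …, 8` and arrays `0, 1, 2` belong to the procedure; the others are at the disposal
of the range maximum structure. -/

abbrev rN : ℕ := 0
abbrev rI : ℕ := 1
abbrev rJ : ℕ := 2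
abbrev rMax : ℕ := 3
/-- The register in which a range maximum query returns its answer. -/
abbrev rIdx : ℕ := 4
abbrev rK : ℕ := 5
abbrev rV : ℕ := 6
abbrev rOne : ℕ := 7
abbrev rZero : ℕ := 8
/-- The input: the suffix array of `s$`. -/
abbrev arrB : ℕ := 0
/-- The suffix array without the entry of the suffix `$`. -/
abbrev arrA : ℕ := 1
/-- The output. -/
abbrev arrL : ℕ := 2

/-- The procedure, with a program `pre` that preprocesses `A[0], …, A[n-1]` for range maximum
queries and a program `qry` that finds the index of the maximum in the range `A[0], …, A[i-1]`. -/
def lsaProgram (pre qry : Cmd) : Cmd :=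
  block [
    .const rZero 0,
    .const rOne 1,
    -- A[k] ← B[k+1] for k = 0, …, n-1
    .const rK 0,
    .loop rK rN (block [
      .arith .plus rJ rK rOne,
      .load rV arrB rJ,
      .store arrA rK rV,
      .move rK rJ]),
    -- L[k] ← -1 for k = 0, …, n-1
    .const rV (-1),
    .const rK 0,
    .loop rK rN (block [
      .store arrL rK rV,
      .arith .plus rK rK rOne]),
    pre,
    .move rI rN,
    .move rJ rN,
    .const rMax 0,
    -- while A[0], …, A[i-1] is a non-empty range
    .loop rZero rI (block [
      qry,
      .move rI rIdx,
      .load rMax arrA rI,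
      .arith .minus rJ rJ rOne,
      .store arrL rJ rMax])]

/-- `pre` and `qry` implement range maximum queries for the prefix ranges of the array `A`, with
linear preprocessing and constant query time: on every array `A[0], …, A[n-1]` with entries in
`{0, …, n}`, `pre` takes at most `c * (n + 1)` steps, and afterwards `qry` finds, for every
`1 ≤ i ≤ n`, in at most `c` steps an index `m < i` at which `A[0], …, A[i-1]` is maximal. The
machine words are bounded by `c * (n + 1)`. The programs leave the registers and arrays of the
calling procedure alone, except that `qry` writes its answer into `rIdx`. -/
def IsPrefixRMQ (c : ℕ) (pre qry : Cmd) : Prop :=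
  ∀ (n : ℕ) (σ : State), σ.reg rN = (n : ℤ) →
    (∀ k : ℕ, k < n → 0 ≤ σ.arr arrA k ∧ σ.arr arrA k ≤ (n : ℤ)) →
    (∀ r : ℕ, 9 ≤ r → σ.reg r = 0) → (∀ a : ℕ, 3 ≤ a → ∀ k : ℕ, σ.arr a k = 0) →
    ∃ (t : ℕ) (S : Finset (ℕ × ℕ)) (σ₁ : State),
      Exec (c * (n + 1)) pre σ t S σ₁ ∧ t ≤ c * (n + 1) ∧
      (∀ r : ℕ, r < 9 → σ₁.reg r = σ.reg r) ∧ (∀ a : ℕ, a < 3 → σ₁.arr a = σ.arr a) ∧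
      ∀ (i : ℕ) (τ : State), 1 ≤ i → i ≤ n → τ.reg rN = (n : ℤ) → τ.reg rI = (i : ℤ) →
        (∀ a : ℕ, a ≠ arrL → τ.arr a = σ₁.arr a) →
        ∃ (t' : ℕ) (S' : Finset (ℕ × ℕ)) (τ' : State),
          Exec (c * (n + 1)) qry τ t' S' τ' ∧ t' ≤ c ∧
          (∀ r : ℕ, r < 9 → r ≠ rIdx → τ'.reg r = τ.reg r) ∧ τ'.arr = τ.arr ∧
          ∃ m : ℕ, m < i ∧ τ'.reg rIdx = (m : ℤ) ∧
            ∀ k : ℕ, k < i → τ.arr arrA k ≤ τ.arr arrA m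

/-- The initial state for `s`: the length of `s` in `rN`, the suffix array of `s$` in the array
`arrB`, and `0` elsewhere. -/
def inputState {α : Type*} [LinearOrder α] (s : List α) : State where
  reg := fun r => if r = rN then (s.length : ℤ) else 0
  arr := fun a k => if a = arrB then (((suffixArray (withSentinel s)).getD k 0 : ℕ) : ℤ) else 0

/-- The returned array of length `n`: the Lyndon suffix array of `s`, filled up with entries `-1`
on the left. -/
noncomputable def paddedLSA {α : Type*} [LinearOrder α] (s : List α) : List ℤ :=
  List.replicate (s.length - (lyndonSuffixArray s).length) (-1) ++
    (lyndonSuffixArray s).map (fun p => (p : ℤ))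

end LyndonSuffix

/-!
A suffix of `s` is a Lyndon word if and only if it is smaller than all its proper non-empty
suffixes, that is, than all suffixes of `s` that start after it (`isLyndon_iff_lt_suffix`,
`isLyndon_drop_iff`). For the suffix array `A` this means: `A[k]` is the start of a Lyndon suffix if
and only if `A[k]` is larger than all entries before it. The end marker only puts the entry of the
suffix `$` in front of the suffix array of `s` (`suffixArray_withSentinel`).

The index of the maximum of `A[0], …, A[i-1]` is the last such record below `i`, so repeated
prefix maximum queries enumerate the records, and hence the Lyndon suffixes, from right to left
(`computeLoop_suffixArray`).

For the program, `Runs` is a Hoare-style judgement for `Exec` with a bound on the number of steps.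
A prefix maximum structure is given by a table of the indices of all prefix maxima
(`isPrefixRMQ_prefixMax`). With any such structure, the program follows `computeLoop`, because the
entries of `A` are distinct and the answers of the queries therefore unique (`mainLoop_round`);
each round costs a bounded number of steps (`runs_lsaProgram`). As a step accesses at most one cell,
the space bound follows from the time bound (`Exec.card_le`).
-/

namespace LyndonSuffix

/-! ### Lexicographic order and concatenation -/

section Lex

variable {α : Type*} [LinearOrder α]

theorem append_lt_append_of_lt_of_not_prefix {v w : List α} (h : v < w) (hp : ¬ v <+: w)
    (x y : List α) : v ++ x < w ++ y := by
  replace h : List.Lex (· < ·) v w := h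
  change List.Lex (· < ·) (v ++ x) (w ++ y)
  induction h with
  | nil => exact absurd List.nil_prefix hp
  | cons _ ih => exact List.Lex.cons (ih fun hq => hp (List.cons_prefix_cons.2 ⟨rfl, hq⟩))
  | rel hab => exact List.Lex.rel hab

theorem append_lt_append_of_lt_of_length_eq {v w : List α} (h : v < w) (hl : v.length = w.length)
    (x y : List α) : v ++ x < w ++ y :=
  append_lt_append_of_lt_of_not_prefix h (fun hp => h.ne (hp.eq_of_length hl)) x y

theorem append_left_strictMono (u : List α) : StrictMono (u ++ ·) :=
  fun _ _ h => List.Lex.append_left _ h u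

theorem le_append_right (u v : List α) : u ≤ u ++ v := by
  have h := (append_left_strictMono u).monotone (show [] ≤ v from not_lt.1 nofun)
  simpa using h

/-- In the definition of `withSentinel` the letters are cast by a coercion of whole lists. -/
theorem withSentinel_eq_map {β : Type*} (s : List β) :
    withSentinel s = s.map (WithBot.some) ++ [⊥] := by
  induction s with
  | nil => rfl
  | cons a s ih => exact congrArg (WithBot.some a :: ·) ih

theorem withSentinel_strictMono : StrictMono (withSentinel : List α → List (WithBot α)) := by
  intro u v h
  replace h : List.Lex (· < ·) u v := h
  change List.Lex (· < ·) (withSentinel u) (withSentinel v)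
  induction h with
  | nil => exact List.Lex.rel (WithBot.bot_lt_coe _)
  | cons _ ih => exact List.Lex.cons ih
  | rel hab => exact List.Lex.rel (WithBot.coe_lt_coe.2 hab)

end Lex

/-! ### Lyndon words and their suffixes -/

/-- Commuting words are powers of a common word. -/
theorem exists_replicate_of_append_comm {α : Type*} (u v : List α) (h : u ++ v = v ++ u) :
    ∃ (z : List α) (a b : ℕ),
      u = (List.replicate a z).flatten ∧ v = (List.replicate b z).flatten := by
  induction hk : u.length + v.length using Nat.strong_induction_on generalizing u v with
  | _ k ih =>
  wlog hl : u.length ≤ v.length generalizing u v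
  · obtain ⟨z, a, b, ha, hb⟩ := this v u h.symm (by omega) (by omega)
    exact ⟨z, b, a, hb, ha⟩
  rcases u.eq_nil_or_concat with rfl | ⟨u', c, hu⟩
  · exact ⟨v, 0, 1, by simp, by simp⟩
  have hpos : 0 < u.length := by simp [hu]
  -- Euclid's algorithm: the shorter word is a prefix of the longer one and can be cut off.
  obtain ⟨x, rfl⟩ : u <+: v :=
    List.prefix_of_prefix_length_le (List.prefix_append u v) (h ▸ List.prefix_append v u) hl
  have hx : u ++ x = x ++ u := by simpa using h
  obtain ⟨z, a, b, ha, hb⟩ := ih (u.length + x.length) (by simp at hk; omega) u x hx rfl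
  refine ⟨z, a, a + b, ha, ?_⟩
  rw [List.replicate_add, List.flatten_append, ← ha, ← hb]

theorem IsPrimitive.append_ne_append_comm {α : Type*} {u v : List α} (h : IsPrimitive (u ++ v))
    (hu : u ≠ []) (hv : v ≠ []) : u ++ v ≠ v ++ u := by
  intro he
  obtain ⟨z, a, b, ha, hb⟩ := exists_replicate_of_append_comm u v he
  have hz : z ≠ [] := by rintro rfl; simp [ha] at hu
  have ha0 : a ≠ 0 := by rintro rfl; simp [ha] at hu
  have hb0 : b ≠ 0 := by rintro rfl; simp [hb] at hv
  refine h z (a + b) hz (by omega) ?_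
  rw [List.replicate_add, List.flatten_append, ← ha, ← hb]

/-- A non-empty word is Lyndon if and only if it is smaller than all its proper non-empty
suffixes. -/
theorem isLyndon_iff_lt_suffix {α : Type*} [LinearOrder α] {w : List α} (hw : w ≠ []) :
    IsLyndon w ↔ ∀ u v : List α, w = u ++ v → u ≠ [] → v ≠ [] → w < v := by
  constructor
  · rintro ⟨-, hprim, hmin⟩ u v rfl hu hv
    have hne := hprim.append_ne_append_comm hu hv
    have hrot : u ++ v ≤ v ++ u := hmin _ List.isRotated_append
    by_contra! hle
    have hlt : v < u ++ v :=
      lt_of_le_of_ne hle fun he => hu (by simpa using he)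
    by_cases hp : v <+: u ++ v
    · obtain ⟨x, hx⟩ := hp
      have hlen : u.length = x.length := by
        have := congrArg List.length hx
        simp at this
        omega
      -- Rotating `u ++ v = v ++ x` in both ways gives `x ≤ u` and `u ≤ x`.
      have hxu : x ≤ u := by
        rw [← hx] at hrot
        exact (append_left_strictMono v).le_iff_le.1 hrot
      have hux : u ≤ x := by
        have h2 : u ++ v ≤ x ++ v := hmin _ (hx ▸ List.isRotated_append)
        by_contra! hlt'
        exact absurd (append_lt_append_of_lt_of_length_eq hlt' hlen.symm v v) (not_lt.2 h2)
      exact hne (by rw [← hx, le_antisymm hxu hux])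
    · have h2 := append_lt_append_of_lt_of_not_prefix hlt hp u []
      rw [List.append_nil] at h2
      exact absurd h2 (not_lt.2 hrot)
  · intro h
    refine ⟨hw, ?_, ?_⟩
    · rintro u k hu hk rfl
      obtain ⟨j, rfl⟩ := Nat.exists_eq_add_of_le' hk
      -- A proper power of `u` has `u` as a suffix and as a prefix.
      have h1 := h (List.replicate (j + 1) u).flatten u
        (by simp [List.replicate_succ']) (by simp [List.replicate_succ, hu]) hu
      have h2 := le_append_right u (List.replicate (j + 1) u).flatten
      rw [List.replicate_succ, List.flatten_cons] at h1
      exact absurd h1 (not_lt.2 h2)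
    · intro v hv
      obtain ⟨k, hk, rfl⟩ := List.isRotated_iff_mod.1 hv
      rw [List.rotate_eq_drop_append_take hk]
      by_cases h0 : k = 0
      · simp [h0]
      by_cases hl : k = w.length
      · simp [hl]
      refine (h (w.take k) (w.drop k) (List.take_append_drop k w).symm ?_ ?_).le.trans
        (le_append_right _ _)
      · simp [h0, hw]
      · simpa using by omega

theorem isLyndon_drop_iff {α : Type*} [LinearOrder α] {s : List α} {p : ℕ} (hp : p < s.length) :
    IsLyndon (s.drop p) ↔ ∀ q, p < q → q < s.length → s.drop p < s.drop q := by
  rw [isLyndon_iff_lt_suffix (by simpa using hp)]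
  constructor
  · intro h q hpq hq
    refine h ((s.drop p).take (q - p)) _ ?_ (by simp; omega) (by simpa using hq)
    conv_lhs => rw [← List.take_append_drop (q - p) (s.drop p)]
    rw [List.drop_drop, Nat.add_sub_cancel' hpq.le]
  · intro h u v huv hu hv
    have hv' : v = s.drop (p + u.length) := by rw [← List.drop_drop, huv, List.drop_left]
    have hlen := congrArg List.length hv'
    have hu0 := List.length_pos_iff.2 hu
    have hv0 := List.length_pos_iff.2 hv
    rw [List.length_drop] at hlen
    rw [hv']
    exact h _ (by omega) (by omega)

/-! ### Sorting positions by their suffixes -/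

theorem drop_injOn {α : Type*} (w : List α) : Set.InjOn (fun p => w.drop p) (Set.Iic w.length) := by
  intro p hp q hq h
  have := congrArg List.length h
  simp at this hp hq
  omega

section Sorting

variable {α : Type*} [LinearOrder α]

theorem sortBySuffix_perm (w : List α) (P : List ℕ) : (sortBySuffix w P).Perm P :=
  List.mergeSort_perm _ _

theorem sortBySuffix_pairwise_le (w : List α) (P : List ℕ) :
    (sortBySuffix w P).Pairwise fun p q => w.drop p ≤ w.drop q := by
  have h := List.pairwise_mergeSort (le := fun p q => decide (w.drop p ≤ w.drop q))
    (fun a b c hab hbc => by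
      simp only [decide_eq_true_eq] at *
      exact hab.trans hbc)
    (fun a b => by
      simp only [Bool.or_eq_true, decide_eq_true_eq]
      exact le_total _ _) P
  exact h.imp fun h => by simpa using h

theorem sortBySuffix_pairwise_lt {w : List α} {P : List ℕ} (hP : P.Nodup)
    (hb : ∀ p ∈ P, p ≤ w.length) :
    (sortBySuffix w P).Pairwise fun p q => w.drop p < w.drop q := by
  have hperm := sortBySuffix_perm w P
  refine List.Pairwise.imp_of_mem ?_
    ((sortBySuffix_pairwise_le w P).and (hperm.nodup_iff.2 hP))
  rintro p q hp hq ⟨hle, hne⟩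
  exact lt_of_le_of_ne hle fun he =>
    hne (drop_injOn w (hb p (hperm.mem_iff.1 hp)) (hb q (hperm.mem_iff.1 hq)) he)

theorem eq_sortBySuffix {w : List α} {P l : List ℕ} (hperm : l.Perm P)
    (hl : l.Pairwise fun p q => w.drop p ≤ w.drop q) (hb : ∀ p ∈ P, p ≤ w.length) :
    l = sortBySuffix w P := by
  refine List.Perm.eq_of_pairwise (le := fun p q => w.drop p ≤ w.drop q) ?_ hl
    (sortBySuffix_pairwise_le w P) (hperm.trans (sortBySuffix_perm w P).symm)
  intro p q hp hq h1 h2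
  exact drop_injOn w (hb p (hperm.mem_iff.1 hp))
    (hb q ((sortBySuffix_perm w P).mem_iff.1 hq)) (le_antisymm h1 h2)

theorem length_suffixArray (s : List α) : (suffixArray s).length = s.length := by
  simpa [suffixArray] using (sortBySuffix_perm s (List.range s.length)).length_eq

theorem mem_suffixArray {s : List α} {p : ℕ} : p ∈ suffixArray s ↔ p < s.length :=
  (sortBySuffix_perm s _).mem_iff.trans List.mem_range

theorem nodup_suffixArray (s : List α) : (suffixArray s).Nodup :=
  (sortBySuffix_perm s _).nodup_iff.2 List.nodup_range

theorem suffixArray_pairwise_lt (s : List α) :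
    (suffixArray s).Pairwise fun p q => s.drop p < s.drop q :=
  sortBySuffix_pairwise_lt List.nodup_range fun _ hp => (List.mem_range.1 hp).le

/-- The suffix `$` comes first, and the end marker does not change the order of the suffixes
of `s`. -/
theorem suffixArray_withSentinel (s : List α) :
    suffixArray (withSentinel s) = s.length :: suffixArray s := by
  have hlen : (withSentinel s).length = s.length + 1 := by simp [withSentinel]
  have hdrop : ∀ p ≤ s.length, (withSentinel s).drop p = withSentinel (s.drop p) := by
    intro p hp
    rw [withSentinel_eq_map, withSentinel_eq_map,
      List.drop_append_of_le_length (by simpa using hp), List.map_drop]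
  symm
  refine eq_sortBySuffix ?_ ?_ fun p hp => (List.mem_range.1 hp).le
  · rw [hlen, List.range_succ]
    exact ((sortBySuffix_perm s _).cons _).trans (List.perm_append_singleton _ _).symm
  · refine List.pairwise_cons.2 ⟨fun q hq => ?_, ?_⟩
    · rw [hdrop _ le_rfl, hdrop _ (mem_suffixArray.1 hq).le]
      refine withSentinel_strictMono.monotone ?_
      rw [List.drop_length]
      exact not_lt.1 (List.not_lt_nil _)
    · refine List.Pairwise.imp_of_mem ?_ (suffixArray_pairwise_lt s)
      intro p q hp hq h
      rw [hdrop _ (mem_suffixArray.1 hp).le, hdrop _ (mem_suffixArray.1 hq).le]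
      exact (withSentinel_strictMono h).le

open Classical in
theorem lyndonSuffixArray_eq_filter (s : List α) :
    lyndonSuffixArray s = (suffixArray s).filter fun p => decide (IsLyndon (s.drop p)) := by
  symm
  refine eq_sortBySuffix ((sortBySuffix_perm s _).filter _) ?_ ?_
  · exact ((suffixArray_pairwise_lt s).imp fun h => h.le).filter _
  · intro p hp
    exact (List.mem_range.1 (List.mem_of_mem_filter hp)).le

end Sorting

/-! ### The loop finds the Lyndon suffixes -/

theorem computeLoop_zero (A out : List ℕ) : computeLoop A 0 out = out := by
  rw [computeLoop]
  rfl

/-- One round of the loop, for an index of a strict maximum. -/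
theorem computeLoop_eq_of_forall_lt {A : List ℕ} {i m : ℕ} (hm : m < i)
    (h : ∀ k, k < i → k ≠ m → A.getD k 0 < A.getD m 0) (out : List ℕ) :
    computeLoop A i out = computeLoop A m (A.getD m 0 :: out) := by
  have hmax : (List.range i).argmax (fun k => A.getD k 0) = some m := by
    rw [List.argmax_eq_some_iff]
    refine ⟨List.mem_range.2 hm, fun k hk => ?_, fun k hk hle => ?_⟩
    · by_cases hkm : k = m
      · rw [hkm]
      · exact (h k (List.mem_range.1 hk) hkm).le
    · by_cases hkm : k = m
      · rw [hkm]
      · exact absurd hle (not_le.2 (h k (List.mem_range.1 hk) hkm))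
  rw [computeLoop]
  split
  · next h0 => rw [hmax] at h0; cases h0
  · next idx h0 => rw [hmax] at h0; cases h0; rfl

theorem exists_strict_max {A : List ℕ} (hA : A.Nodup) {i : ℕ} (hi : i ≤ A.length) (h0 : 0 < i) :
    ∃ m < i, ∀ k, k < i → k ≠ m → A.getD k 0 < A.getD m 0 := by
  obtain ⟨m, hm, hmax⟩ := (Finset.range i).exists_max_image (fun k => A.getD k 0)
    ⟨0, Finset.mem_range.2 h0⟩
  rw [Finset.mem_range] at hm
  refine ⟨m, hm, fun k hk hkm => lt_of_le_of_ne (hmax k (Finset.mem_range.2 hk)) fun he => hkm ?_⟩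
  rw [List.getD_eq_getElem _ _ (by omega), List.getD_eq_getElem _ _ (by omega)] at he
  exact (hA.getElem_inj_iff).1 he

open Classical in
/-- Let `m` be the index of the maximum of `A[0], …, A[i-1]`, where `A` is the suffix array and
the entries from `A[i]` on belong to larger suffixes. All suffixes starting after `A[m]` are
larger than the one at `A[m]`, so the latter is Lyndon; the suffixes between `m` and `i` are not,
because the one at `A[m]` is a smaller suffix of them. -/
theorem computeLoop_suffixArray {α : Type*} [LinearOrder α] (s : List α) (i : ℕ)
    (hi : i ≤ s.length) (out : List ℕ) :
    computeLoop (suffixArray s) i out =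
      ((suffixArray s).take i).filter (fun p => decide (IsLyndon (s.drop p))) ++ out := by
  induction i using Nat.strong_induction_on generalizing out with
  | _ i ih =>
  have hlen := length_suffixArray s
  rcases Nat.eq_zero_or_pos i with rfl | h0
  · simp [computeLoop_zero]
  obtain ⟨m, hm, hmax⟩ := exists_strict_max (nodup_suffixArray s) (hi.trans_eq hlen.symm) h0
  rw [computeLoop_eq_of_forall_lt hm hmax, ih m hm (hm.le.trans hi)]
  have hlt : ∀ k (hk : k < s.length), (suffixArray s)[k] < s.length := fun k hk =>
    mem_suffixArray.1 (List.getElem_mem _)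
  have hmono : ∀ k l (hkl : k < l) (hl : l < s.length),
      s.drop (suffixArray s)[k] < s.drop (suffixArray s)[l] := fun k l hkl hl =>
    List.pairwise_iff_getElem.1 (suffixArray_pairwise_lt s) k l (by omega) (by omega) hkl
  have hmax' : ∀ k (hk : k < i), k ≠ m → (suffixArray s)[k] < (suffixArray s)[m] := by
    intro k hk hkm
    have := hmax k hk hkm
    rwa [List.getD_eq_getElem _ _ (by omega), List.getD_eq_getElem _ _ (by omega)] at this
  have hlyn : IsLyndon (s.drop (suffixArray s)[m]) := by
    rw [isLyndon_drop_iff (hlt m (by omega))]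
    intro q hq hqn
    obtain ⟨k, hk, rfl⟩ := List.getElem_of_mem (mem_suffixArray.2 hqn)
    have hmk : m < k := by
      by_contra hkm
      have := hmax' k (by omega) (by rintro rfl; exact lt_irrefl _ hq)
      omega
    exact hmono m k hmk (by omega)
  have hsplit : (suffixArray s).take i = (suffixArray s).take m ++
      (suffixArray s)[m] :: ((suffixArray s).take i).drop (m + 1) := by
    conv_lhs => rw [← List.take_append_drop m ((suffixArray s).take i)]
    rw [List.take_take, min_eq_left hm.le,
      List.drop_eq_getElem_cons (by rw [List.length_take]; omega), List.getElem_take]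
  have hnone : (((suffixArray s).take i).drop (m + 1)).filter
      (fun p => decide (IsLyndon (s.drop p))) = [] := by
    rw [List.filter_eq_nil_iff]
    intro p hp
    obtain ⟨k, hk, rfl⟩ := List.getElem_of_mem hp
    rw [List.length_drop, List.length_take] at hk
    rw [List.getElem_drop, List.getElem_take, decide_eq_true_eq,
      isLyndon_drop_iff (hlt _ (by omega))]
    intro h
    exact lt_asymm (hmono m (m + 1 + k) (by omega) (by omega))
      (h _ (hmax' _ (by omega) (by omega)) (hlt m (by omega)))
  rw [hsplit, List.filter_append, List.filter_cons, if_pos (by simpa using hlyn), hnone,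
    List.getD_eq_getElem _ _ (by omega)]
  simp

theorem computeLoop_suffixArray_length {α : Type*} [LinearOrder α] (s : List α) :
    computeLoop (suffixArray s) s.length [] = lyndonSuffixArray s := by
  classical
  rw [computeLoop_suffixArray s _ le_rfl, lyndonSuffixArray_eq_filter, List.append_nil,
    List.take_of_length_le (length_suffixArray s).le]

/-! ### Executions with a time bound -/

theorem Exec.mono {W W' : ℕ} (hW : W ≤ W') {p : Cmd} {σ σ' : State} {t : ℕ}
    {S : Finset (ℕ × ℕ)} (h : Exec W p σ t S σ') : Exec W' p σ t S σ' := by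
  have hc : (W : ℤ) ≤ W' := by exact_mod_cast hW
  induction h with
  | skip σ => exact .skip σ
  | const σ r v hv => exact .const σ r v (hv.trans hc)
  | move σ r x hv => exact .move σ r x (hv.trans hc)
  | arith σ o r x y hv => exact .arith σ o r x y (hv.trans hc)
  | load σ r a x k hk h hv => exact .load σ r a x k hk (h.trans hW) (hv.trans hc)
  | store σ a x y k hk h hv => exact .store σ a x y k hk (h.trans hW) (hv.trans hc)
  | seq p q σ σ₁ σ₂ t₁ t₂ S₁ S₂ _ _ ih₁ ih₂ => exact .seq p q σ σ₁ σ₂ t₁ t₂ S₁ S₂ ih₁ ih₂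
  | iteTrue x y p q σ σ₁ t S hb _ ih => exact .iteTrue x y p q σ σ₁ t S hb ih
  | iteFalse x y p q σ σ₁ t S hb _ ih => exact .iteFalse x y p q σ σ₁ t S hb ih
  | loopDone x y p σ hb => exact .loopDone x y p σ hb
  | loopStep x y p σ σ₁ σ₂ t₁ t₂ S₁ S₂ hb _ _ ih₁ ih₂ =>
    exact .loopStep x y p σ σ₁ σ₂ t₁ t₂ S₁ S₂ hb ih₁ ih₂

/-- Each step accesses at most one cell, so a time bound is a space bound. -/
theorem Exec.card_le {W : ℕ} {p : Cmd} {σ σ' : State} {t : ℕ} {S : Finset (ℕ × ℕ)}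
    (h : Exec W p σ t S σ') : S.card ≤ t := by
  induction h with
  | seq p q σ σ₁ σ₂ t₁ t₂ S₁ S₂ _ _ ih₁ ih₂ =>
    exact (Finset.card_union_le _ _).trans (Nat.add_le_add ih₁ ih₂)
  | loopStep x y p σ σ₁ σ₂ t₁ t₂ S₁ S₂ hb _ _ ih₁ ih₂ =>
    have := Finset.card_union_le S₁ S₂
    omega
  | iteTrue => omega
  | iteFalse => omega
  | _ => simp

/-- Started in `σ`, the program `p` halts after at most `T` steps, with machine words bounded by
`W`, in a state that satisfies `Q`. -/
def Runs (W : ℕ) (p : Cmd) (σ : State) (T : ℕ) (Q : State → Prop) : Prop :=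
  ∃ (t : ℕ) (S : Finset (ℕ × ℕ)) (σ' : State), Exec W p σ t S σ' ∧ t ≤ T ∧ Q σ'

namespace Runs

variable {W W' T T' : ℕ} {σ : State} {Q : State → Prop} {p q : Cmd} {ps : List Cmd}

theorem mono (h : Runs W p σ T Q) (hW : W ≤ W') (hT : T ≤ T') : Runs W' p σ T' Q := by
  obtain ⟨t, S, τ, he, ht, hQ⟩ := h
  exact ⟨t, S, τ, he.mono hW, ht.trans hT, hQ⟩

theorem imp {Q' : State → Prop} (h : Runs W p σ T Q) (hQ : ∀ τ, Q τ → Q' τ) :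
    Runs W p σ T Q' := by
  obtain ⟨t, S, τ, he, ht, hτ⟩ := h
  exact ⟨t, S, τ, he, ht, hQ τ hτ⟩

theorem nil (h : Q σ) : Runs W (block []) σ 1 Q :=
  ⟨1, ∅, σ, .skip σ, le_rfl, h⟩

theorem cons {R : State → Prop} (hp : Runs W p σ T R)
    (hps : ∀ τ, R τ → Runs W (block ps) τ T' Q) : Runs W (block (p :: ps)) σ (T + T') Q := by
  obtain ⟨t, S, τ, he, ht, hR⟩ := hp
  obtain ⟨t', S', τ', he', ht', hQ⟩ := hps τ hR
  exact ⟨t + t', S ∪ S', τ', .seq _ _ _ _ _ _ _ _ _ he he', Nat.add_le_add ht ht', hQ⟩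

theorem cons_of_exec {S : Finset (ℕ × ℕ)} {τ : State} (hp : Exec W p σ 1 S τ)
    (hps : Runs W (block ps) τ T Q) : Runs W (block (p :: ps)) σ (T + 1) Q := by
  rw [Nat.add_comm]
  exact cons (R := (· = τ)) ⟨1, S, τ, hp, le_rfl, rfl⟩ fun _ h => h ▸ hps

theorem skip (h : Runs W (block ps) σ T Q) : Runs W (block (.skip :: ps)) σ (T + 1) Q :=
  cons_of_exec (.skip σ) h

theorem const {r : ℕ} {v : ℤ} (hv : |v| ≤ (W : ℤ)) (h : Runs W (block ps) (σ.setReg r v) T Q) :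
    Runs W (block (.const r v :: ps)) σ (T + 1) Q :=
  cons_of_exec (.const σ r v hv) h

theorem move {r x : ℕ} {v : ℤ} (hx : σ.reg x = v) (hv : |v| ≤ (W : ℤ))
    (h : Runs W (block ps) (σ.setReg r v) T Q) :
    Runs W (block (.move r x :: ps)) σ (T + 1) Q := by
  subst hx
  exact cons_of_exec (.move σ r x hv) h

theorem arith {o : Op} {r x y : ℕ} {v : ℤ} (ho : o.eval (σ.reg x) (σ.reg y) = v)
    (hv : |v| ≤ (W : ℤ)) (h : Runs W (block ps) (σ.setReg r v) T Q) :
    Runs W (block (.arith o r x y :: ps)) σ (T + 1) Q := by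
  subst ho
  exact cons_of_exec (.arith σ o r x y hv) h

theorem load {r a x k : ℕ} {v : ℤ} (hk : σ.reg x = k) (hW : k ≤ W) (ha : σ.arr a k = v)
    (hv : |v| ≤ (W : ℤ)) (h : Runs W (block ps) (σ.setReg r v) T Q) :
    Runs W (block (.load r a x :: ps)) σ (T + 1) Q := by
  subst ha
  exact cons_of_exec (.load σ r a x k hk hW hv) h

theorem store {a x y k : ℕ} {v : ℤ} (hk : σ.reg x = k) (hW : k ≤ W) (hy : σ.reg y = v)
    (hv : |v| ≤ (W : ℤ)) (h : Runs W (block ps) (σ.setCell a k v) T Q) :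
    Runs W (block (.store a x y :: ps)) σ (T + 1) Q := by
  subst hy
  exact cons_of_exec (.store σ a x y k hk hW hv) h

theorem ite {x y : ℕ} (hp : σ.reg x < σ.reg y → Runs W (block (p :: ps)) σ T Q)
    (hq : ¬ σ.reg x < σ.reg y → Runs W (block (q :: ps)) σ T Q) :
    Runs W (block (.ite x y p q :: ps)) σ (T + 1) Q := by
  by_cases hb : σ.reg x < σ.reg y
  · obtain ⟨_, _, τ, ⟨⟩, ht, hQ⟩ := hp hb
    next t₁ t₂ S₁ S₂ h₁ h₂ =>
    exact ⟨_, _, τ, .seq _ _ _ _ _ _ _ _ _ (.iteTrue _ _ _ _ _ _ _ _ hb h₁) h₂, by omega, hQ⟩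
  · obtain ⟨_, _, τ, ⟨⟩, ht, hQ⟩ := hq hb
    next t₁ t₂ S₁ S₂ h₁ h₂ =>
    exact ⟨_, _, τ, .seq _ _ _ _ _ _ _ _ _ (.iteFalse _ _ _ _ _ _ _ _ hb h₁) h₂, by omega, hQ⟩

/-- The rule for loops: `I k` is an invariant in which `k` bounds the number of rounds that are
left. -/
theorem loop {x y : ℕ} (I : ℕ → State → Prop)
    (step : ∀ k τ, I k τ → τ.reg x < τ.reg y → Runs W p τ T fun τ' => ∃ k' < k, I k' τ')
    {k : ℕ} (h : I k σ) :
    Runs W (.loop x y p) σ ((T + 1) * k + 1) fun τ => ¬ τ.reg x < τ.reg y ∧ ∃ k', I k' τ := by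
  induction k using Nat.strong_induction_on generalizing σ with
  | _ k ih =>
  by_cases hb : σ.reg x < σ.reg y
  · obtain ⟨t, S, τ, he, ht, k', hk', hI⟩ := step k σ h hb
    obtain ⟨t', S', τ', he', ht', hQ⟩ := ih k' hk' hI
    refine ⟨_, _, τ', .loopStep _ _ _ _ _ _ _ _ _ _ hb he he', ?_, hQ⟩
    have := Nat.mul_le_mul_left (T + 1) hk'
    rw [Nat.mul_succ] at this
    omega
  · exact ⟨1, ∅, σ, .loopDone _ _ _ _ hb, by omega, hb, k, h⟩

end Runs

@[simp]
theorem State.setReg_reg (σ : State) (r r' : ℕ) (v : ℤ) :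
    (σ.setReg r v).reg r' = if r' = r then v else σ.reg r' := by
  simp [State.setReg, Function.update_apply]

@[simp]
theorem State.setReg_arr (σ : State) (r : ℕ) (v : ℤ) : (σ.setReg r v).arr = σ.arr := rfl

@[simp]
theorem State.setCell_reg (σ : State) (a k : ℕ) (v : ℤ) : (σ.setCell a k v).reg = σ.reg := rfl

theorem State.setCell_arr (σ : State) (a k b l : ℕ) (v : ℤ) :
    (σ.setCell a k v).arr b l = if b = a ∧ l = k then v else σ.arr b l := by
  by_cases hb : b = a
  · subst hb
    simp [State.setCell, Function.update_apply]
  · simp [State.setCell, hb]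

@[simp]
theorem State.setCell_arr_same (σ : State) (a k l : ℕ) (v : ℤ) :
    (σ.setCell a k v).arr a l = if l = k then v else σ.arr a l := by
  simp [State.setCell_arr]

theorem State.setCell_arr_of_ne (σ : State) {a b : ℕ} (k : ℕ) (v : ℤ) (h : b ≠ a) :
    (σ.setCell a k v).arr b = σ.arr b := by
  simp [State.setCell, h]

/-! ### A range maximum structure for prefix ranges -/

/-- Store in cell `k` of array `3` an index of the maximum of `A[0], …, A[k]`. Register `9` holds
`k`, register `11` the index of the current maximum, register `12` this maximum. -/
def prefixMaxPre : Cmd :=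
  block [
    .const 10 1,
    .loop 9 rN (block [
      .load 13 arrA 9,
      .ite 12 13 (.move 11 9) .skip,
      .load 12 arrA 11,
      .store 3 9 11,
      .arith .plus 9 9 10])]

/-- Look up the answer for the range `A[0], …, A[i-1]` in cell `i - 1` of array `3`. -/
def prefixMaxQry : Cmd :=
  block [
    .const 9 1,
    .arith .minus 9 rI 9,
    .load rIdx 3 9]

/-- Before the round for index `k`, with `r = n - k`: register `11` holds the index of a maximum
of `A[0], …, A[k-1]` (`0` if there is none yet). The registers and arrays of the caller are those
of `σ`. -/
structure PrefixMaxInv (n : ℕ) (σ : State) (r : ℕ) (τ : State) (k m : ℕ) : Prop where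
  add_eq : k + r = n
  reg_lt : ∀ x < 9, τ.reg x = σ.reg x
  arr_lt : ∀ a < 3, τ.arr a = σ.arr a
  reg_k : τ.reg 9 = k
  reg_one : τ.reg 10 = 1
  reg_m : τ.reg 11 = m
  m_lt : m < k ∨ k = 0 ∧ m = 0 ∧ τ.reg 12 = 0
  reg_max : 0 < k → τ.reg 12 = σ.arr arrA m
  le_max : ∀ l < k, σ.arr arrA l ≤ τ.reg 12
  table : ∀ l < k, ∃ m' ≤ l, τ.arr 3 l = m' ∧ ∀ l' ≤ l, σ.arr arrA l' ≤ σ.arr arrA m'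

/-- A round for index `k` makes `k` the new index of the maximum if `A[k]` is larger than the old
maximum, and records the index in cell `k` of the table. -/
theorem prefixMaxPre_round {n r k m : ℕ} {σ τ : State}
    (hA : ∀ k : ℕ, k < n → 0 ≤ σ.arr arrA k ∧ σ.arr arrA k ≤ (n : ℤ))
    (hI : PrefixMaxInv n σ r τ k m) (hk : k < n) :
    Runs (8 * (n + 1)) (block [
      .load 13 arrA 9,
      .ite 12 13 (.move 11 9) .skip,
      .load 12 arrA 11,
      .store 3 9 11,
      .arith .plus 9 9 10]) τ 7
      fun τ' => ∃ r' < r, ∃ k' m', PrefixMaxInv n σ r' τ' k' m' := by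
  obtain ⟨h1, h2, h3, h4, h5, h6, h7, h8, h9, h10⟩ := hI
  have hAτ : τ.arr arrA = σ.arr arrA := h3 _ (by decide)
  have hbd : ∀ l < n, |σ.arr arrA l| ≤ ((8 * (n + 1) : ℕ) : ℤ) := by
    intro l hl
    have := hA l hl
    rw [abs_of_nonneg this.1]
    omega
  -- The rest of the round, once register `11` holds the index `m'` of the new maximum.
  have tail : ∀ (τ₁ : State) (m' : ℕ), m' ≤ k → (∀ l ≤ k, σ.arr arrA l ≤ σ.arr arrA m') →
      (∀ x < 9, τ₁.reg x = σ.reg x) → τ₁.arr = τ.arr → τ₁.reg 9 = k → τ₁.reg 10 = 1 →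
      τ₁.reg 11 = m' →
      Runs (8 * (n + 1)) (block [.load 12 arrA 11, .store 3 9 11, .arith .plus 9 9 10]) τ₁ 4
        fun τ' => ∃ r' < r, ∃ k' m', PrefixMaxInv n σ r' τ' k' m' := by
    intro τ₁ m' hm' hmax ht2 ht3 ht4 ht5 ht6
    refine Runs.load (k := m') ht6 (by omega) (by rw [ht3, hAτ]) (hbd m' (by omega)) ?_
    refine Runs.store (k := k) (v := m') (by simpa using ht4) (by omega) (by simpa using ht6)
      (by rw [Nat.abs_cast]; omega) ?_
    refine Runs.arith (v := ((k + 1 : ℕ) : ℤ)) (by simp [Op.eval, ht4, ht5])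
      (by rw [Nat.abs_cast]; omega) ?_
    refine Runs.nil ⟨r - 1, by omega, k + 1, m', ?_⟩
    constructor
    · omega
    · intro x hx
      simp [hx.ne, (show x ≠ 12 by omega), ht2 x hx]
    · intro a ha
      rw [State.setReg_arr, State.setCell_arr_of_ne _ _ _ (by omega), State.setReg_arr, ht3,
        h3 a ha]
    · simp
    · simpa using ht5
    · simpa using ht6
    · exact Or.inl (by omega)
    · simp
    · intro l hl
      simpa using hmax l (by omega)
    · intro l hl
      by_cases hlk : l = k
      · subst hlk
        exact ⟨m', hm', by simp, hmax⟩
      · simpa [hlk, ht3] using h10 l (by omega)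
  refine Runs.load (k := k) h4 (by omega) (congrFun hAτ k) (hbd k hk) ?_
  refine Runs.ite (fun hlt => ?_) (fun hlt => ?_)
  · simp only [State.setReg_reg, if_true] at hlt
    refine Runs.move (v := k) (by simpa using h4) (by rw [Nat.abs_cast]; omega) ?_
    refine tail _ k le_rfl (fun l hl => ?_) (fun x hx => ?_) rfl (by simpa using h4)
      (by simpa using h5) (by simp)
    · rcases hl.lt_or_eq with hl | rfl
      · have := h9 l hl
        simp at hlt
        omega
      · rfl
    · simp [(show x ≠ 11 by omega), (show x ≠ 13 by omega), h2 x hx]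
  · simp only [State.setReg_reg, if_true] at hlt
    simp at hlt
    refine Runs.skip ?_
    have hval : τ.reg 12 = σ.arr arrA m := by
      rcases h7 with h | ⟨rfl, rfl, h⟩
      · exact h8 (by omega)
      · have := hA 0 hk
        omega
    refine tail _ m (by omega) (fun l hl => ?_) (fun x hx => ?_) rfl (by simpa using h4)
      (by simpa using h5) (by simpa using h6)
    · rw [← hval]
      rcases hl.lt_or_eq with hl | rfl
      · exact h9 l hl
      · exact hlt
    · simp [(show x ≠ 13 by omega), h2 x hx]

theorem isPrefixRMQ_prefixMax : IsPrefixRMQ 8 prefixMaxPre prefixMaxQry := by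
  intro n σ hn hA hreg harr
  have hpre : Runs (8 * (n + 1)) prefixMaxPre σ ((7 + 1) * n + 1 + 1 + 1)
      fun τ => ∃ m, PrefixMaxInv n σ 0 τ n m := by
    refine Runs.const (T := (7 + 1) * n + 1 + 1) (by rw [abs_one]; omega) ?_
    refine Runs.cons (Runs.loop (fun r τ => ∃ k m, PrefixMaxInv n σ r τ k m) ?_ (k := n)
      ⟨0, 0, ?_⟩) ?_
    · rintro r τ ⟨k, m, hI⟩ hlt
      rw [hI.reg_k, hI.reg_lt 0 (by decide), hn, Nat.cast_lt] at hlt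
      exact prefixMaxPre_round hA hI hlt
    · constructor <;> simp +contextual [hreg, Nat.ne_of_lt]
      omega
    · rintro τ ⟨hlt, r, k, m, hI⟩
      have hadd := hI.add_eq
      rw [hI.reg_k, hI.reg_lt 0 (by decide), hn, Nat.cast_lt] at hlt
      obtain rfl : k = n := by omega
      obtain rfl : r = 0 := by omega
      exact Runs.nil ⟨m, hI⟩
  obtain ⟨t, S, σ₁, he, ht, m, hI⟩ := hpre
  refine ⟨t, S, σ₁, he, by omega, hI.reg_lt, hI.arr_lt, ?_⟩
  intro i τ hi hin hτN hτI hτarr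
  obtain ⟨m', hm', h3, hmax⟩ := hI.table (i - 1) (by omega)
  have hA' : τ.arr arrA = σ.arr arrA := by rw [hτarr _ (by decide), hI.arr_lt _ (by decide)]
  have hq : Runs (8 * (n + 1)) prefixMaxQry τ 4 fun τ' =>
      (∀ r : ℕ, r < 9 → r ≠ rIdx → τ'.reg r = τ.reg r) ∧ τ'.arr = τ.arr ∧
        τ'.reg rIdx = (m' : ℤ) := by
    refine Runs.const (by rw [abs_one]; omega) ?_
    refine Runs.arith (v := ((i - 1 : ℕ) : ℤ)) (by simp [Op.eval, hτI]; omega)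
      (by rw [Nat.abs_cast]; omega) ?_
    refine Runs.load (k := i - 1) (v := m') (by simp) (by omega)
      (by simp [hτarr, h3]) (by rw [Nat.abs_cast]; omega) ?_
    refine Runs.nil ⟨fun r hr hr' => ?_, rfl, by simp⟩
    simp [hr', (show r ≠ 9 by omega)]
  obtain ⟨t', S', τ', he', ht', h1, h2, h4⟩ := hq
  refine ⟨t', S', τ', he', by omega, h1, h2, m', by omega, h4, fun k hk => ?_⟩
  rw [hA']
  exact hmax k (by omega)

/-! ### The program -/

/-- Before the round for index `k` of the loop that copies the suffix array, without its first
entry, to the array `A`; `r` rounds are left. -/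
structure CopyInv (n : ℕ) (A : List ℕ) (σ : State) (r : ℕ) (τ : State) (k : ℕ) : Prop where
  add_eq : k + r = n
  reg_n : τ.reg rN = n
  reg_zero : τ.reg rZero = 0
  reg_one : τ.reg rOne = 1
  reg_k : τ.reg rK = k
  reg_ge : ∀ x : ℕ, 9 ≤ x → τ.reg x = σ.reg x
  arr_ne : ∀ a : ℕ, a ≠ arrA → τ.arr a = σ.arr a
  arr_A : ∀ l < k, τ.arr arrA l = (A.getD l 0 : ℕ)

/-- Before the round for index `k` of the loop that fills the array `L` with entries `-1`;
`r` rounds are left. -/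
structure FillInv (n : ℕ) (σ : State) (r : ℕ) (τ : State) (k : ℕ) : Prop where
  add_eq : k + r = n
  reg_n : τ.reg rN = n
  reg_zero : τ.reg rZero = 0
  reg_one : τ.reg rOne = 1
  reg_k : τ.reg rK = k
  reg_v : τ.reg rV = -1
  reg_ge : ∀ x : ℕ, 9 ≤ x → τ.reg x = σ.reg x
  arr_ne : ∀ a : ℕ, a ≠ arrL → τ.arr a = σ.arr a
  arr_L : ∀ l < k, τ.arr arrL l = -1

/-- The state in the main loop, after the range has shrunk to `A[0], …, A[i-1]` and the values
`out` have been found; `σ₁` is the state after the preprocessing, and `res` the final output.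
Since `i ≤ j`, there is still room in `L` whenever the range is non-empty. -/
structure MainInv (n : ℕ) (A : List ℕ) (σ₁ : State) (res : List ℕ) (i : ℕ) (τ : State)
    (j : ℕ) (out : List ℕ) : Prop where
  reg_n : τ.reg rN = n
  reg_zero : τ.reg rZero = 0
  reg_one : τ.reg rOne = 1
  reg_i : τ.reg rI = i
  reg_j : τ.reg rJ = j
  add_eq : j + out.length = n
  le_j : i ≤ j
  arr_eq : ∀ a : ℕ, a ≠ arrL → τ.arr a = σ₁.arr a
  arr_L : ∀ k < n, τ.arr arrL k = if k < j then -1 else ((out.getD (k - j) 0 : ℕ) : ℤ)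
  loop_eq : computeLoop A i out = res

/-- The property of a query program, after preprocessing has led to the state `σ₁`. -/
def AnswersQueries (c n : ℕ) (qry : Cmd) (σ₁ : State) : Prop :=
  ∀ (i : ℕ) (τ : State), 1 ≤ i → i ≤ n → τ.reg rN = (n : ℤ) → τ.reg rI = (i : ℤ) →
    (∀ a : ℕ, a ≠ arrL → τ.arr a = σ₁.arr a) →
    Runs (c * (n + 1)) qry τ c fun τ' =>
      (∀ r : ℕ, r < 9 → r ≠ rIdx → τ'.reg r = τ.reg r) ∧ τ'.arr = τ.arr ∧
      ∃ m : ℕ, m < i ∧ τ'.reg rIdx = (m : ℤ) ∧ ∀ k : ℕ, k < i → τ.arr arrA k ≤ τ.arr arrA m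

/-- One round of the main loop; its result does not depend on how the query program works, since
the index of a maximum is unique. -/
theorem mainLoop_round {c n W : ℕ} {A : List ℕ} {qry : Cmd} {σ₁ τ : State} {res : List ℕ}
    {i j : ℕ} {out : List ℕ} (hq : AnswersQueries c n qry σ₁) (hcW : c * (n + 1) ≤ W)
    (hnW : n + 1 ≤ W) (hnd : A.Nodup) (hlen : A.length = n) (hbd : ∀ p ∈ A, p < n)
    (hA : ∀ k < n, σ₁.arr arrA k = (A.getD k 0 : ℕ))
    (hI : MainInv n A σ₁ res i τ j out) (hi : 0 < i) :
    Runs W (block [qry, .move rI rIdx, .load rMax arrA rI, .arith .minus rJ rJ rOne,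
      .store arrL rJ rMax]) τ (c + 5)
      fun τ' => ∃ i' < i, ∃ j' out', MainInv n A σ₁ res i' τ' j' out' := by
  obtain ⟨h1, h2, h3, h4, h5, h6, h7, h8, h9, h10⟩ := hI
  refine Runs.cons ((hq i τ hi (by omega) h1 h4 h8).mono hcW le_rfl) ?_
  rintro τ' ⟨hreg, harr, m, hmi, hidx, hmax⟩
  have hv : τ'.arr arrA m = (A.getD m 0 : ℕ) := by
    rw [harr, h8 _ (by decide), hA m (by omega)]
  have hget : ∀ k, k < n → A.getD k 0 < n := by
    intro k hk
    rw [List.getD_eq_getElem _ _ (by omega)]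
    exact hbd _ (List.getElem_mem _)
  -- The entries are distinct, so the index returned by the query is that of a strict maximum.
  have hstrict : ∀ k, k < i → k ≠ m → A.getD k 0 < A.getD m 0 := by
    intro k hk hkm
    have hle := hmax k hk
    rw [h8 _ (by decide), hA k (by omega), hA m (by omega), Nat.cast_le] at hle
    refine lt_of_le_of_ne hle fun he => hkm ?_
    rw [List.getD_eq_getElem _ _ (by omega), List.getD_eq_getElem _ _ (by omega)] at he
    exact hnd.getElem_inj_iff.1 he
  have hAm := hget m (by omega)
  refine Runs.move hidx (by rw [Nat.abs_cast]; omega) ?_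
  refine Runs.load (k := m) (by simp) (by omega) hv (by rw [Nat.abs_cast]; omega) ?_
  have hj : τ'.reg rJ = j := (hreg _ (by decide) (by decide)).trans h5
  have hone : τ'.reg rOne = 1 := (hreg _ (by decide) (by decide)).trans h3
  refine Runs.arith (v := ((j - 1 : ℕ) : ℤ)) (by simp [Op.eval, hj, hone]; omega)
    (by rw [Nat.abs_cast]; omega) ?_
  refine Runs.store (k := j - 1) (v := (A.getD m 0 : ℕ)) (by simp) (by omega) (by simp)
    (by rw [Nat.abs_cast]; omega) ?_
  refine Runs.nil ⟨m, hmi, j - 1, A.getD m 0 :: out, ?_⟩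
  constructor
  · simpa using (hreg _ (by decide) (by decide)).trans h1
  · simpa using (hreg _ (by decide) (by decide)).trans h2
  · simpa using hone
  · simp
  · simp
  · simp only [List.length_cons]; omega
  · omega
  · intro a ha
    rw [State.setCell_arr_of_ne _ _ _ ha]
    exact (congrFun harr a).trans (h8 a ha)
  · intro k hk
    simp only [State.setCell_arr_same, State.setReg_arr, harr, h9 k hk]
    rcases lt_trichotomy k (j - 1) with h | rfl | h
    · rw [if_neg h.ne, if_pos (by omega), if_pos h]
    · simp
    · rw [if_neg h.ne', if_neg (by omega), if_neg (by omega),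
        show k - (j - 1) = (k - j) + 1 by omega, List.getD_cons_succ]
  · rw [← h10, computeLoop_eq_of_forall_lt hmi hstrict]

theorem runs_copyLoop {n W : ℕ} {A : List ℕ} {σ : State} (hnW : n + 1 ≤ W)
    (hA : ∀ k < n, A.getD k 0 < n) (hB : ∀ k < n, σ.arr arrB (k + 1) = (A.getD k 0 : ℕ))
    (hI : CopyInv n A σ n σ 0) :
    Runs W (.loop rK rN (block [
      .arith .plus rJ rK rOne,
      .load rV arrB rJ,
      .store arrA rK rV,
      .move rK rJ])) σ (6 * n + 1) fun τ => CopyInv n A σ 0 τ n := by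
  refine ((Runs.loop (T := 5) (k := n) (fun r τ => ∃ k, CopyInv n A σ r τ k) ?_
    ⟨0, hI⟩).imp ?_)
  · rintro r τ ⟨k, h1, h2, h3, h4, h5, h6, h7, h8⟩ hlt
    rw [h2, h5, Nat.cast_lt] at hlt
    have := hA k hlt
    refine Runs.arith (v := ((k + 1 : ℕ) : ℤ)) (by simp [Op.eval, h4, h5])
      (by rw [Nat.abs_cast]; omega) ?_
    refine Runs.load (k := k + 1) (v := (A.getD k 0 : ℕ)) (by simp) (by omega)
      (by rw [State.setReg_arr, h7 _ (by decide), hB k hlt]) (by rw [Nat.abs_cast]; omega) ?_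
    refine Runs.store (k := k) (v := (A.getD k 0 : ℕ)) (by simpa using h5)
      (by omega) (by simp) (by rw [Nat.abs_cast]; omega) ?_
    refine Runs.move (v := ((k + 1 : ℕ) : ℤ)) (by simp) (by rw [Nat.abs_cast]; omega) ?_
    refine Runs.nil ⟨r - 1, by omega, k + 1, by omega, by simpa using h2, by simpa using h3,
      by simpa using h4, by simp, fun x hx => ?_, fun a ha => ?_, fun l hl => ?_⟩
    · simp [h6 x hx, (show x ≠ 5 by omega), (show x ≠ 6 by omega), (show x ≠ 2 by omega)]
    · rw [State.setReg_arr, State.setCell_arr_of_ne _ _ _ ha]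
      exact h7 a ha
    · by_cases hlk : l = k
      · simp [hlk]
      · simpa [hlk] using h8 l (by omega)
  · rintro τ ⟨hlt, r, k, hI⟩
    rw [hI.reg_n, hI.reg_k, Nat.cast_lt] at hlt
    have := hI.add_eq
    obtain rfl : k = n := by omega
    obtain rfl : r = 0 := by omega
    exact hI

theorem runs_fillLoop {n W : ℕ} {σ : State} (hnW : n + 1 ≤ W) (hI : FillInv n σ n σ 0) :
    Runs W (.loop rK rN (block [
      .store arrL rK rV,
      .arith .plus rK rK rOne])) σ (4 * n + 1) fun τ => FillInv n σ 0 τ n := by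
  refine ((Runs.loop (T := 3) (k := n) (fun r τ => ∃ k, FillInv n σ r τ k) ?_
    ⟨0, hI⟩).imp ?_)
  · rintro r τ ⟨k, h1, h2, h3, h4, h5, h6, h7, h8, h9⟩ hlt
    rw [h2, h5, Nat.cast_lt] at hlt
    refine Runs.store (k := k) (v := -1) h5 (by omega) h6 (by simp; omega) ?_
    refine Runs.arith (v := ((k + 1 : ℕ) : ℤ)) (by simp [Op.eval, h4, h5])
      (by rw [Nat.abs_cast]; omega) ?_
    refine Runs.nil ⟨r - 1, by omega, k + 1, by omega, by simpa using h2, by simpa using h3,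
      by simpa using h4, by simp, by simpa using h6, fun x hx => ?_, fun a ha => ?_,
      fun l hl => ?_⟩
    · simp [h7 x hx, (show x ≠ 5 by omega)]
    · rw [State.setReg_arr, State.setCell_arr_of_ne _ _ _ ha]
      exact h8 a ha
    · by_cases hlk : l = k
      · simp [hlk]
      · simpa [hlk] using h9 l (by omega)
  · rintro τ ⟨hlt, r, k, hI⟩
    rw [hI.reg_n, hI.reg_k, Nat.cast_lt] at hlt
    have := hI.add_eq
    obtain rfl : k = n := by omega
    obtain rfl : r = 0 := by omega
    exact hI

/-- In the definition of `paddedLSA` the positions are cast by a coercion of whole lists. -/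
theorem paddedLSA_eq_map {α : Type*} [LinearOrder α] (s : List α) :
    paddedLSA s = List.replicate (s.length - (lyndonSuffixArray s).length) (-1) ++
      (lyndonSuffixArray s).map (Nat.cast : ℕ → ℤ) := by
  rw [paddedLSA]
  congr 1
  induction lyndonSuffixArray s with
  | nil => rfl
  | cons p l ih => exact congrArg ((p : ℤ) :: ·) ih

theorem runs_lsaProgram {α : Type*} [LinearOrder α] (s : List α) {c W : ℕ} {pre qry : Cmd}
    (h : IsPrefixRMQ c pre qry) (hcW : c * (s.length + 1) ≤ W) (hnW : s.length + 1 ≤ W) :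
    Runs W (lsaProgram pre qry) (inputState s) ((2 * c + 20) * (s.length + 1))
      fun τ => (List.range s.length).map (τ.arr arrL) = paddedLSA s := by
  generalize hn : s.length = n at *
  have hlen : (suffixArray s).length = n := (length_suffixArray s).trans hn
  have hbd : ∀ p ∈ suffixArray s, p < n := fun p hp => hn ▸ mem_suffixArray.1 hp
  have hget : ∀ k < n, (suffixArray s).getD k 0 < n := by
    intro k hk
    rw [List.getD_eq_getElem _ _ (by omega)]
    exact hbd _ (List.getElem_mem _)
  refine Runs.mono (W := W) (T := 6 * n + 1 + (4 * n + 1 + (c * (n + 1) +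
    ((c + 5 + 1) * n + 1 + 1 + 1 + 1 + 1)) + 1 + 1) + 1 + 1 + 1) ?_ le_rfl ?_
  · refine Runs.const (by simp) (Runs.const (by rw [abs_one]; omega) (Runs.const (by simp) ?_))
    refine Runs.cons (runs_copyLoop (n := n) (A := suffixArray s) hnW hget (fun k _ => ?_) ?_) ?_
    · simp [inputState, suffixArray_withSentinel]
    · constructor <;> simp [inputState, hn]
    intro τ hτ
    -- Filling `L` with entries `-1`.
    refine Runs.const (by simp; omega) (Runs.const (by simp) ?_)
    refine Runs.cons (runs_fillLoop (n := n) hnW ?_) ?_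
    · constructor <;> simp [hτ.reg_n, hτ.reg_zero, hτ.reg_one]
    intro τ' hτ'
    -- The memory of the range maximum structure is still untouched, so `pre` may be run.
    have hreg : ∀ x : ℕ, 9 ≤ x → τ'.reg x = 0 := by
      intro x hx
      rw [hτ'.reg_ge x hx]
      simp [hτ.reg_ge x hx, inputState, (show x ≠ 0 by omega), (show x ≠ 5 by omega),
        (show x ≠ 6 by omega), (show x ≠ 7 by omega), (show x ≠ 8 by omega)]
    have harr : ∀ a : ℕ, 3 ≤ a → ∀ k : ℕ, τ'.arr a k = 0 := by
      intro a ha k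
      have hL : a ≠ arrL := by rintro rfl; exact absurd ha (by decide)
      have hA : a ≠ arrA := by rintro rfl; exact absurd ha (by decide)
      rw [hτ'.arr_ne a hL]
      simp [hτ.arr_ne a hA, inputState, (show a ≠ 0 by omega)]
    have hA : ∀ k < n, τ'.arr arrA k = ((suffixArray s).getD k 0 : ℕ) := by
      intro k hk
      rw [hτ'.arr_ne _ (by decide)]
      exact hτ.arr_A k hk
    obtain ⟨t, S, σ₁, he, ht, hreg₁, harr₁, hqry⟩ := h n τ' hτ'.reg_n
      (fun k hk => by have := hget k hk; rw [hA k hk]; omega) hreg harr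
    have hq : AnswersQueries c n qry σ₁ := hqry
    refine Runs.cons (R := (· = σ₁)) ⟨t, S, σ₁, he.mono hcW, ht, rfl⟩ fun τ₁ hτ₁ => ?_
    subst hτ₁
    have hn₁ : τ₁.reg rN = n := (hreg₁ _ (by decide)).trans hτ'.reg_n
    refine Runs.move hn₁ (by rw [Nat.abs_cast]; omega) ?_
    refine Runs.move (v := n) (by simpa using hn₁) (by rw [Nat.abs_cast]; omega) ?_
    refine Runs.const (T := (c + 5 + 1) * n + 1 + 1) (by simp) ?_
    refine Runs.cons (Runs.loop (k := n) (T := c + 5) (fun i τ => ∃ j out,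
      MainInv n (suffixArray s) τ₁ (lyndonSuffixArray s) i τ j out) ?_ ⟨n, [], ?_⟩) ?_
    · rintro i τ₂ ⟨j, out, hI⟩ hlt
      rw [hI.reg_zero, hI.reg_i] at hlt
      refine mainLoop_round hq hcW hnW (nodup_suffixArray s) hlen hbd (fun k hk => ?_) hI
        (by omega)
      rw [harr₁ _ (by decide), hA k hk]
    · constructor
      · simpa using hn₁
      · simpa using (hreg₁ _ (by decide)).trans hτ'.reg_zero
      · simpa using (hreg₁ _ (by decide)).trans hτ'.reg_one
      · simp
      · simp
      · simp
      · exact le_rfl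
      · intro a _
        rfl
      · intro k hk
        rw [if_pos hk]
        exact (congrFun (harr₁ _ (by decide)) k).trans (hτ'.arr_L k hk)
      · rw [← hn, computeLoop_suffixArray_length]
    rintro τ₂ ⟨hlt, i, j, out, hI⟩
    obtain rfl : i = 0 := by
      have := hI.reg_i
      rw [hI.reg_zero] at hlt
      omega
    -- The loop ends with `i = 0`, where the values found are the result of `computeLoop`.
    have hout : out = lyndonSuffixArray s := by rw [← hI.loop_eq, computeLoop_zero]
    subst hout
    have hadd := hI.add_eq
    refine Runs.nil (List.ext_getElem (by simp [paddedLSA_eq_map]; omega) fun k hk hk' => ?_)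
    rw [List.length_map, List.length_range] at hk
    have hL := hI.arr_L k hk
    simp only [List.getElem_map, List.getElem_range, paddedLSA_eq_map,
      List.getElem_append, List.length_replicate, List.getElem_replicate]
    rw [hL]
    by_cases hkj : k < j
    · rw [if_pos hkj, dif_pos (by omega)]
    · rw [if_neg hkj, dif_neg (by omega), List.getD_eq_getElem _ _ (by omega)]
      simp only [show s.length - (lyndonSuffixArray s).length = j by omega]
  · ring_nf
    omega

end LyndonSuffix

theorem mainTheorem3 :
    -- the list of values found by the procedure is the Lyndon suffix array
    (∀ (α : Type*) [LinearOrder α] (s : List α),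
      LyndonSuffix.computeLSA (LyndonSuffix.suffixArray (LyndonSuffix.withSentinel s)) =
        LyndonSuffix.lyndonSuffixArray s) ∧
    -- range maximum queries as the procedure needs them are available on the machine
    (∃ (c : ℕ) (pre qry : LyndonSuffix.Cmd), LyndonSuffix.IsPrefixRMQ c pre qry) ∧
    -- with any such structure, the procedure runs in linear time and space and is correct
    (∀ c : ℕ, ∃ C : ℕ, ∀ pre qry : LyndonSuffix.Cmd, LyndonSuffix.IsPrefixRMQ c pre qry →
      ∀ (α : Type*) [LinearOrder α] (s : List α),
        ∃ (t : ℕ) (S : Finset (ℕ × ℕ)) (σ' : LyndonSuffix.State),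
          LyndonSuffix.Exec (C * (s.length + 1)) (LyndonSuffix.lsaProgram pre qry)
            (LyndonSuffix.inputState s) t S σ' ∧
          t ≤ C * (s.length + 1) ∧ S.card ≤ C * (s.length + 1) ∧
          (List.range s.length).map (σ'.arr LyndonSuffix.arrL) = LyndonSuffix.paddedLSA s) := by
  refine ⟨fun α _ s => ?_, ⟨8, _, _, LyndonSuffix.isPrefixRMQ_prefixMax⟩,
    fun c => ⟨2 * c + 20, fun pre qry h α _ s => ?_⟩⟩
  · rw [LyndonSuffix.computeLSA, LyndonSuffix.suffixArray_withSentinel, List.tail_cons,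
      LyndonSuffix.length_suffixArray, LyndonSuffix.computeLoop_suffixArray_length]
  · obtain ⟨t, S, σ', he, ht, hL⟩ := LyndonSuffix.runs_lsaProgram s h
      (W := (2 * c + 20) * (s.length + 1)) (Nat.mul_le_mul_right _ (by omega))
      (Nat.le_mul_of_pos_left _ (by omega))
    exact ⟨t, S, σ', he, ht, he.card_le.trans ht, hL⟩
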